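/- Let $\kappa$ be a strongly compact cardinal, i.e. an uncountable cardinal such that each (proper) $\kappa$-complete filter on any set $I$ can be extended to a $\kappa$-complete ultrafilter on $I$, and let $R$ be an (associative, unital, not necessarily commutative) ring with $|R|<\kappa$. Call an $R$-module $M$ $<\kappa$-presented if it has a presentation with fewer than $\kappa$ generators and fewer than $\kappa$ relations, and call an epimorphism $g:B\to C$ of $R$-modules $\kappa$-pure if $\operatorname{Hom}_R(M,g):\operatorname{Hom}_R(M,B)\to\operatorname{Hom}_R(M,C)$ is surjective for each $<\kappa$-presented $R$-module $M$. Then each $\kappa$-pure epimorphism $g:B\to C$ of $R$-modules with $B$ projective splits, i.e. there is an $R$-homomorphism $s:C\to B$ with $gs=1_C$. In particular, the category $\mathcal P_0$ of all projective $R$-modules and all $R$-homomorphisms between them is $\kappa$-accessible; that is, $\kappa$ is regular, $\mathcal P_0$ has $\kappa$-directed colimits, and there is a set $\mathcal S$ of $\kappa$-presentable objects of $\mathcal P_0$ (objects $S$ such that $\operatorname{Hom}(S,-)$ preserves $\kappa$-directed colimits in $\mathcal P_0$) such that every object of $\mathcal P_0$ is a $\kappa$-directed colimit of objects from $\mathcal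 S$. -/

import Mathlib

open CategoryTheory

universe u

/-- An uncountable cardinal `κ` is *strongly compact* if every proper `κ`-complete filter on any
set `I` can be extended to a `κ`-complete ultrafilter on `I`. Here a filter is `κ`-complete if it is
closed under intersections of fewer than `κ` of its members. -/
structure IsStronglyCompact (κ : Cardinal.{u}) : Prop where
  aleph0_lt : Cardinal.aleph0 < κ
  exists_ultrafilter : ∀ (I : Type u) (F : Filter I), F.NeBot → CardinalInterFilter F κ →
    ∃ U : Ultrafilter I, (U : Filter I) ≤ F ∧ CardinalInterFilter (U : Filter I) κ

/-- An `R`-module `M` is `<κ`-presented if it has a presentation by fewer than `κ` generators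
(indexed by `ι`) and fewer than `κ` relations (the elements of `S`). -/
def IsLTPresented (κ : Cardinal.{u}) (R : Type u) [Ring R] (M : Type u) [AddCommGroup M]
    [Module R M] : Prop :=
  ∃ (ι : Type u) (p : (ι →₀ R) →ₗ[R] M) (S : Set (ι →₀ R)),
    Cardinal.mk ι < κ ∧ Cardinal.mk S < κ ∧ Function.Surjective p ∧
      Submodule.span R S = LinearMap.ker p

/-- An epimorphism `g : B → C` of `R`-modules is `κ`-*pure* if `Hom(M, B) → Hom(M, C)` is
surjective for every `<κ`-presented module `M`. -/
structure IsPureEpi (κ : Cardinal.{u}) {R : Type u} [Ring R] {B C : Type u} [AddCommGroup B]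
    [Module R B] [AddCommGroup C] [Module R C] (g : B →ₗ[R] C) : Prop where
  surjective : Function.Surjective g
  exists_lift : ∀ (M : Type u) [AddCommGroup M] [Module R M], IsLTPresented κ R M →
    ∀ f : M →ₗ[R] C, ∃ f' : M →ₗ[R] B, g ∘ₗ f' = f

/-- The category of all projective `R`-modules and all `R`-homomorphisms between them, as a full
subcategory of the category of `R`-modules. -/
abbrev ProjectiveModuleCat (R : Type u) [Ring R] : Type (u + 1) :=
  ObjectProperty.FullSubcategory (fun M : ModuleCat.{u} R => Module.Projective R M)

/-!
Let `𝒞` be the class of modules `C` admitting a `κ`-pure epimorphism `B → C` with `B` free. The heart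
of the proof is that modules in `𝒞` are projective; then every `κ`-pure epimorphism with projective
source splits.

*Strong compactness.* Over each subset of `C` of cardinality `< κ` there is a section to `B`. With
respect to a fine `κ`-complete ultrafilter on the set of these subsets, the sections assemble to an
embedding of `C` into an ultrapower of `B`. Since `|R| < κ`, the ultrapower of a free module is free.
Any system of fewer than `κ` equations can be tested at a single index, so finitely many elements of
`C` can be retracted back, and the cokernel of the embedding is again in `𝒞`
(`IsPureQuotientOfFree.exists_embedding`). Dually the kernel of `B → C` is in `𝒞`
(`IsPureEpi.isPureQuotientOfFree_ker`). Hence `C` is a module of cycles in a two-sided exact complex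
of free modules all of whose cycle modules are locally split, that is, in a pure acyclic complex.

*Contractibility.* A pure acyclic complex of free modules is contractible
(`IsLocallySplitExact.exists_contraction`; results of this kind are due to Benson–Goodearl and
Neeman), so `C` is projective. The complex is folded into a single free module with a differential
`d`. Every basis vector lies in a countable contractible subcomplex spanned by basis vectors, where
a contraction is a telescoping sum of local quasi-inverses of `d`. The quotient by a contractible
subcomplex spanned by basis vectors is again pure acyclic, and contractions extend along such
subcomplexes, so Zorn's lemma applies.

*Accessibility.* A `κ`-filtered colimit is a `κ`-pure quotient of the direct sum of its diagram, so
projective modules are closed under `κ`-filtered colimits. Direct summands of free modules of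
rank `< κ` are `κ`-presentable, and a projective module, given as a summand of a free module, is the
`κ`-directed union of its summands cut out by small sets of basis vectors stable under the
idempotent. Finally, `κ` is regular because for singular `κ` a `κ`-complete ultrafilter would
be closed under intersections of `κ` members.
-/

/-! ### Contracting locally split exact differentials on free modules -/

section Contraction

variable {R X : Type*} [Ring R]

open Finsupp

theorem supported_le_of_single_mem {T : Set X} {N : Submodule R (X →₀ R)}
    (h : ∀ x ∈ T, single x 1 ∈ N) : supported R R T ≤ N := by
  rw [supported_eq_span_single, Submodule.span_le]
  rintro _ ⟨x, hx, rfl⟩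
  exact h x hx

theorem eqOn_supported {M : Type*} [AddCommGroup M] [Module R M] {T : Set X}
    {f g : (X →₀ R) →ₗ[R] M} (h : ∀ x ∈ T, f (single x 1) = g (single x 1)) {p : X →₀ R}
    (hp : p ∈ supported R R T) : f p = g p :=
  supported_le_of_single_mem (N := LinearMap.eqLocus f g) h hp

theorem exists_mem_supported_of_monotone {S : ℕ → Finset X} (hS : Monotone S) {p : X →₀ R}
    (hp : p ∈ supported R R {x | ∃ k, x ∈ S k}) : ∃ k, p ∈ supported R R (S k : Set X) := by
  classical
  rw [mem_supported] at hp
  choose k hk using fun x : p.support => hp x.2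
  refine ⟨Finset.univ.sup k, ?_⟩
  rw [mem_supported]
  intro x hx
  exact hS (Finset.le_sup (Finset.mem_univ ⟨x, hx⟩)) (hk ⟨x, hx⟩)

/-- A differential `d` on the free module with basis `X` that is exact (kernel equal to range) and
*locally split*: over any finite set of basis vectors it has a quasi-inverse. Exactness together
with local splitting says that the complex is pure acyclic. -/
structure IsLocallySplitExact (d : (X →₀ R) →ₗ[R] (X →₀ R)) : Prop where
  exact : ∀ p, d p = 0 ↔ ∃ q, d q = p
  exists_split : ∀ S : Finset X, ∃ h : (X →₀ R) →ₗ[R] (X →₀ R),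
    ∀ x ∈ S, d (h (d (single x 1))) = d (single x 1)

/-- The span of the basis vectors in `T` is an exact subcomplex of `(X →₀ R, d)`, and `φ` preserves it
and satisfies `dφ = d` and `φd = 0` there; thus `1 - φ` is a projection onto the cycles of the
subcomplex. Only the values of `φ` on this subcomplex matter. -/
structure IsContraction (d : (X →₀ R) →ₗ[R] (X →₀ R)) (T : Set X)
    (φ : (X →₀ R) →ₗ[R] (X →₀ R)) : Prop where
  map_d : ∀ p ∈ supported R R T, d p ∈ supported R R T
  exact : ∀ p ∈ supported R R T, d p = 0 → ∃ q ∈ supported R R T, d q = p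
  map_φ : ∀ p ∈ supported R R T, φ p ∈ supported R R T
  d_φ : ∀ p ∈ supported R R T, d (φ p) = d p
  φ_d : ∀ p ∈ supported R R T, φ (d p) = 0

namespace IsLocallySplitExact

variable {d : (X →₀ R) →ₗ[R] (X →₀ R)}

theorem d_d (hd : IsLocallySplitExact d) (p : X →₀ R) : d (d p) = 0 :=
  (hd.exact _).2 ⟨p, rfl⟩

/-- The local quasi-inverses can be chosen to have finite rank, because they only matter on the
support of finitely many elements. Besides, by exactness `1 - hd` lifts through `d`. -/
theorem exists_finite_split (hd : IsLocallySplitExact d) (S : Finset X) :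
    ∃ (h : (X →₀ R) →ₗ[R] (X →₀ R)) (e : X → (X →₀ R)) (G : Finset X), S ⊆ G ∧
      (∀ x ∈ S, d (h (d (single x 1))) = d (single x 1)) ∧
      (∀ x ∈ S, d (e x) = single x 1 - h (d (single x 1))) ∧
      (∀ p, h p ∈ supported R R (G : Set X)) ∧
      (∀ x ∈ S, d (single x 1) ∈ supported R R (G : Set X)) ∧
      (∀ x ∈ S, e x ∈ supported R R (G : Set X)) ∧ (S = ∅ → h = 0) := by
  classical
  obtain ⟨h, hh⟩ := hd.exists_split S
  let D : Finset X := S.biUnion fun x => (d (single x 1)).support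
  let h' : (X →₀ R) →ₗ[R] (X →₀ R) :=
    linearCombination R fun y => if y ∈ D then h (single y 1) else 0
  have hD : ∀ x ∈ S, d (single x 1) ∈ supported R R (D : Set X) := fun x hx => by
    rw [mem_supported]
    exact fun y hy => Finset.mem_biUnion.2 ⟨x, hx, hy⟩
  have hh' : ∀ p ∈ supported R R (D : Set X), h' p = h p := fun p hp =>
    eqOn_supported (fun x hx => by simp [h', Finset.mem_coe.1 hx]) hp
  have hsplit : ∀ x ∈ S, d (h' (d (single x 1))) = d (single x 1) := fun x hx => by
    rw [hh' _ (hD x hx), hh x hx]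
  have he : ∀ x, ∃ e, x ∈ S → d e = single x 1 - h' (d (single x 1)) := fun x => by
    by_cases hx : x ∈ S
    · obtain ⟨e, he⟩ := (hd.exact (single x 1 - h' (d (single x 1)))).1
        (by rw [map_sub, hsplit x hx, sub_self])
      exact ⟨e, fun _ => he⟩
    · exact ⟨0, fun h => absurd h hx⟩
  choose e he using he
  let H : Finset X := D.biUnion fun y => (h (single y 1)).support
  let E : Finset X := S.biUnion fun x => (e x).support
  refine ⟨h', e, S ∪ D ∪ H ∪ E, by grind, hsplit, he, fun p => ?_, fun x hx => ?_, fun x hx => ?_,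
    fun hS => ?_⟩
  · refine (supported_le_of_single_mem (T := Set.univ)
      (N := (supported R R _).comap h') fun y _ => ?_) (by simp)
    by_cases hy : y ∈ D
    · have : ((h (single y 1)).support : Set X) ⊆ ↑(S ∪ D ∪ H ∪ E) := fun z hz => by
        have : z ∈ H := Finset.mem_biUnion.2 ⟨y, hy, hz⟩
        simp [this]
      simpa [h', hy, mem_supported] using this
    · simp [h', hy]
  · exact supported_mono (by intro z hz; simp [Finset.mem_coe.1 hz]) (hD x hx)
  · rw [mem_supported]
    intro z hz
    have : z ∈ E := Finset.mem_biUnion.2 ⟨x, hx, hz⟩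
    simp [this]
  · have hD0 : D = ∅ := by simp [D, hS]
    ext y : 2
    simp [h', hD0]

/-- Every basis vector lies in a countable contractible subcomplex. The contraction is a telescoping
sum `∑ hⱼ₊₁ (1 - d hⱼ) d` of local quasi-inverses along an increasing sequence of finite sets,
each of which absorbs the range of the preceding quasi-inverse. -/
theorem exists_isContraction_mem (hd : IsLocallySplitExact d) (z : X) :
    ∃ (T : Set X) (φ : (X →₀ R) →ₗ[R] (X →₀ R)), z ∈ T ∧ IsContraction d T φ := by
  classical
  choose h e G hSG hsplit he hh hdG heG h0 using hd.exists_finite_split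
  let S : ℕ → Finset X := fun k => (fun A => insert z (G A))^[k] ∅
  have hS0 : S 0 = ∅ := rfl
  have hSs (k) : S (k + 1) = insert z (G (S k)) := Function.iterate_succ_apply' _ _ _
  have hGS (k) : (G (S k) : Set X) ⊆ S (k + 1) := by
    rw [hSs]
    exact fun x hx => Finset.mem_coe.2 (Finset.mem_insert_of_mem hx)
  have hS : Monotone S := monotone_nat_of_le_succ fun k => (hSG (S k)).trans (hGS k)
  have hle (k) : supported R R (S k : Set X) ≤ supported R R {x | ∃ k, x ∈ S k} :=
    supported_mono fun x hx => ⟨k, hx⟩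
  have hmap (k) (p) : h (S k) p ∈ supported R R (S (k + 1) : Set X) :=
    supported_mono (hGS k) (hh _ p)
  have hds {k l} (hkl : k ≤ l) {p} (hp : p ∈ supported R R (S k : Set X)) :
      d (h (S l) (d p)) = d p :=
    eqOn_supported (f := d ∘ₗ h (S l) ∘ₗ d) (fun x hx => hsplit (S l) x (hS hkl hx)) hp
  let t : ℕ → (X →₀ R) →ₗ[R] (X →₀ R) := fun j => h (S (j + 1)) ∘ₗ (d - d ∘ₗ h (S j) ∘ₗ d)
  have ht {k j} (hkj : k ≤ j) {p} (hp : p ∈ supported R R (S k : Set X)) : t j p = 0 := by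
    simp [t, hds hkj hp]
  let φ : (X →₀ R) →ₗ[R] (X →₀ R) := linearCombination R fun x =>
    if hx : ∃ k, x ∈ S k then ∑ j ∈ Finset.range (Nat.find hx), t j (single x 1) else 0
  have hφ {k} {p} (hp : p ∈ supported R R (S k : Set X)) :
      φ p = ∑ j ∈ Finset.range k, t j p := by
    have := eqOn_supported (f := φ) (g := ∑ j ∈ Finset.range k, t j) (fun x hx => ?_) hp
    · simpa using this
    · have hx' : ∃ k, x ∈ S k := ⟨k, hx⟩
      simp only [φ, linearCombination_single, one_smul, dif_pos hx', LinearMap.sum_apply]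
      refine Finset.sum_subset (Finset.range_subset_range.2 (Nat.find_min' hx' hx))
        fun j _ hj => ht (k := Nat.find hx') (by simpa using hj) ?_
      exact single_mem_supported R _ (Nat.find_spec hx')
  have hmapd {k p} (hp : p ∈ supported R R (S k : Set X)) :
      d p ∈ supported R R (S (k + 1) : Set X) :=
    (supported_le_of_single_mem (N := (supported R R (S (k + 1) : Set X)).comap d)
      fun x hx => supported_mono (hGS k) (hdG _ x hx)) hp
  refine ⟨{x | ∃ k, x ∈ S k}, φ, ⟨1, by simp [hSs]⟩, ?_, ?_, ?_, ?_, ?_⟩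
  all_goals
    intro p hp
    obtain ⟨k, hk⟩ := exists_mem_supported_of_monotone hS hp
  · exact hle _ (hmapd hk)
  · intro hdp
    -- Since `dp = 0`, the element `p` is the corresponding combination of the `x - h d x = d (e x)`.
    refine ⟨linearCombination R (e (S k)) p, hle (k + 1) ?_, ?_⟩
    · exact (supported_le_of_single_mem
        (N := (supported R R (S (k + 1) : Set X)).comap (linearCombination R (e (S k))))
        fun x hx => by simpa using supported_mono (hGS k) (heG _ x hx)) hk
    · have := eqOn_supported (f := d ∘ₗ linearCombination R (e (S k)))
        (g := LinearMap.id - h (S k) ∘ₗ d) (fun x hx => by simpa using he _ x hx) hk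
      simpa [hdp] using this
  · rw [hφ hk]
    exact Submodule.sum_mem _ fun j _ => hle _ (hmap (j + 1) _)
  · rw [hφ hk, map_sum, Finset.sum_congr rfl fun j _ => (?_ :
      d (t j p) = d (h (S (j + 1)) (d p)) - d (h (S j) (d p))),
      Finset.sum_range_sub fun j => d (h (S j) (d p))]
    · simp [hds le_rfl hk, hS0, h0]
    · simp [t, hds le_rfl (hmap j _)]
  · rw [hφ (hmapd hk)]
    simp [t, hd.d_d]

end IsLocallySplitExact

namespace IsContraction

variable {d φ : (X →₀ R) →ₗ[R] (X →₀ R)} {T : Set X}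

variable (R T) in
/-- The quotient map of the free module on `X` by the span of `T`, as the restriction to the
complement of `T`. -/
noncomputable def restrictCompl : (X →₀ R) →ₗ[R] ((Tᶜ : Set X) →₀ R) := lsubtypeDomain Tᶜ

variable (R T) in
/-- The section of `restrictCompl` given by extension by zero. -/
noncomputable def extendCompl : ((Tᶜ : Set X) →₀ R) →ₗ[R] (X →₀ R) :=
  lmapDomain R R Subtype.val

@[simp]
theorem restrictCompl_extendCompl (p : (Tᶜ : Set X) →₀ R) :
    restrictCompl R T (extendCompl R T p) = p := by
  ext x
  exact mapDomain_apply Subtype.val_injective p x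

theorem restrictCompl_eq_zero_iff {p : X →₀ R} :
    restrictCompl R T p = 0 ↔ p ∈ supported R R T := by
  rw [mem_supported']
  refine ⟨fun h x hx => DFunLike.congr_fun h ⟨x, hx⟩, fun h => ?_⟩
  ext x
  exact h x x.2

theorem sub_extendCompl_mem (p : X →₀ R) :
    p - extendCompl R T (restrictCompl R T p) ∈ supported R R T := by
  rw [← restrictCompl_eq_zero_iff]
  simp

theorem extendCompl_single (x : (Tᶜ : Set X)) :
    extendCompl R T (single x 1) = single x.1 1 := mapDomain_single

variable (d T) in
/-- The differential induced by `d` on the quotient by the span of `T`. -/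
noncomputable def quotientMap : ((Tᶜ : Set X) →₀ R) →ₗ[R] ((Tᶜ : Set X) →₀ R) :=
  restrictCompl R T ∘ₗ d ∘ₗ extendCompl R T

theorem quotientMap_restrictCompl (hT : IsContraction d T φ) (p : X →₀ R) :
    quotientMap d T (restrictCompl R T p) = restrictCompl R T (d p) := by
  have := restrictCompl_eq_zero_iff.2 (hT.map_d _ (sub_extendCompl_mem (T := T) p))
  rw [map_sub, map_sub, sub_eq_zero] at this
  exact this.symm

/-- The quotient of a locally split exact differential by a contractible subcomplex is locally split
exact. The contraction provides a projection `τ` of the whole module onto the cycles of the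
subcomplex; if `h` is a local quasi-inverse of `d` at the finitely many elements `(1 - τ) d x`, then
`μ = 1 - h (1 - τ) d` induces on the quotient a map with values in the cycles which is the identity
on boundaries. -/
theorem isLocallySplitExact_quotientMap (hd : IsLocallySplitExact d) (hT : IsContraction d T φ) :
    IsLocallySplitExact (quotientMap d T) := by
  classical
  have hexact (p) : quotientMap d T p = 0 ↔ ∃ q, quotientMap d T q = p := by
    refine ⟨fun hp => ?_, ?_⟩
    · obtain ⟨q, hq, hdq⟩ := hT.exact _ (restrictCompl_eq_zero_iff.1 hp) (hd.d_d _)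
      obtain ⟨r, hr⟩ := (hd.exact (extendCompl R T p - q)).1 (by simp [hdq])
      refine ⟨restrictCompl R T r, ?_⟩
      rw [hT.quotientMap_restrictCompl, hr, map_sub, restrictCompl_eq_zero_iff.2 hq]
      simp
    · rintro ⟨q, rfl⟩
      change quotientMap d T (restrictCompl R T (d (extendCompl R T q))) = 0
      rw [hT.quotientMap_restrictCompl, hd.d_d, map_zero]
  refine ⟨hexact, fun S => ?_⟩
  -- `τ` is the projection onto the cycles of the subcomplex described in the docstring.
  let τ : (X →₀ R) →ₗ[R] (X →₀ R) :=
    (LinearMap.id - φ) ∘ₗ (LinearMap.id - extendCompl R T ∘ₗ restrictCompl R T)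
  have hτ_of_mem {p} (hp : p ∈ supported R R T) : τ p = p - φ p := by
    simp [τ, restrictCompl_eq_zero_iff.2 hp]
  have hτ_mem (p) : τ p ∈ supported R R T :=
    sub_mem (sub_extendCompl_mem p) (hT.map_φ _ (sub_extendCompl_mem p))
  have hdτ (p) : d (τ p) = 0 := by
    have := hT.d_φ _ (sub_extendCompl_mem (T := T) p)
    simp only [map_sub] at this
    simp [τ, this]
  have hτ_d {p} (hp : p ∈ supported R R T) : τ (d p) = d p := by
    rw [hτ_of_mem (hT.map_d _ hp), hT.φ_d _ hp, sub_zero]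
  let F : Finset (Tᶜ : Set X) := S.biUnion fun x => (quotientMap d T (single x 1)).support
  have hlift (x : (Tᶜ : Set X)) : ∃ q, d q = d (single x.1 1) - τ (d (single x.1 1)) :=
    (hd.exact _).1 (by simp [hd.d_d, hdτ])
  choose q hq using hlift
  obtain ⟨h, hh⟩ := hd.exists_split (F.biUnion fun x => (q x).support)
  have hh' : ∀ x ∈ F, d (h (d (q x))) = d (q x) := fun x hx =>
    eqOn_supported (f := d ∘ₗ h ∘ₗ d)
      (fun y hy => hh y (Finset.mem_biUnion.2 ⟨x, hx, hy⟩)) (mem_supported_support R _)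
  let μ : ((Tᶜ : Set X) →₀ R) →ₗ[R] ((Tᶜ : Set X) →₀ R) :=
    LinearMap.id -
      restrictCompl R T ∘ₗ h ∘ₗ (LinearMap.id - τ) ∘ₗ d ∘ₗ extendCompl R T
  have hdμ : ∀ x ∈ F, quotientMap d T (μ (single x 1)) = 0 := fun x hx => by
    have hx' := hh' x hx
    rw [hq] at hx'
    simp only [μ, LinearMap.sub_apply, LinearMap.comp_apply, LinearMap.id_apply, map_sub,
      hT.quotientMap_restrictCompl, extendCompl_single] at hx' ⊢
    rw [← map_sub (restrictCompl R T), hx', map_sub, restrictCompl_eq_zero_iff.2 (hτ_mem _)]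
    simp [quotientMap, extendCompl_single]
  have hμd (p) : μ (quotientMap d T p) = quotientMap d T p := by
    have : d (extendCompl R T (quotientMap d T p)) =
        -d (d (extendCompl R T p) - extendCompl R T (quotientMap d T p)) := by simp [hd.d_d]
    have h0 : d (extendCompl R T (quotientMap d T p)) - τ (d (extendCompl R T (quotientMap d T p))) = 0 := by
      have h1 := hτ_d (sub_extendCompl_mem (T := T) (d (extendCompl R T p)))
      change τ (d (d (extendCompl R T p) - extendCompl R T (quotientMap d T p))) =
        d (d (extendCompl R T p) - extendCompl R T (quotientMap d T p)) at h1
      rw [this, map_neg, h1, sub_self]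
    simp only [μ, LinearMap.sub_apply, LinearMap.comp_apply, LinearMap.id_apply, h0, map_zero,
      sub_zero]
  have hlift' (x : (Tᶜ : Set X)) : ∃ q, x ∈ F → quotientMap d T q = μ (single x 1) := by
    by_cases hx : x ∈ F
    · obtain ⟨q, hq⟩ := (hexact _).1 (hdμ x hx)
      exact ⟨q, fun _ => hq⟩
    · exact ⟨0, fun h => absurd h hx⟩
  choose q' hq' using hlift'
  refine ⟨linearCombination R q', fun x hx => ?_⟩
  rw [← LinearMap.comp_apply, eqOn_supported (T := (F : Set _)) (g := μ)
    (fun y hy => by simpa using hq' y hy) ?_, hμd]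
  rw [mem_supported]
  exact fun y hy => Finset.mem_biUnion.2 ⟨x, hx, hy⟩

/-- A contraction of a subcomplex and a contraction of a subcomplex of the quotient combine to a
contraction of the preimage: a lift `φ₁` satisfies `dφ₁ = d` and agrees with `φ` on the smaller
subcomplex, while `φ₁d` vanishes only modulo it, and this is repaired by passing to `φ₁²`. -/
theorem exists_extension (hd : IsLocallySplitExact d) (hT : IsContraction d T φ)
    {T' : Set (Tᶜ : Set X)} {ψ : ((Tᶜ : Set X) →₀ R) →ₗ[R] ((Tᶜ : Set X) →₀ R)}
    (hT' : IsContraction (quotientMap d T) T' ψ) :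
    ∃ φ' : (X →₀ R) →ₗ[R] (X →₀ R), IsContraction d (T ∪ Subtype.val '' T') φ' ∧
      ∀ x ∈ T, φ' (single x 1) = φ (single x 1) := by
  classical
  set W : Set X := T ∪ Subtype.val '' T' with hW
  have hTW : supported R R T ≤ supported R R W := supported_mono Set.subset_union_left
  have hext {p} (hp : p ∈ supported R R T') : extendCompl R T p ∈ supported R R W :=
    (supported_le_of_single_mem (N := (supported R R W).comap (extendCompl R T)) fun x hx => by
      rw [Submodule.mem_comap, extendCompl_single]
      exact single_mem_supported R _ (Or.inr ⟨x, hx, rfl⟩)) hp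
  have hmem (p) : p ∈ supported R R W ↔ restrictCompl R T p ∈ supported R R T' := by
    refine ⟨fun hp => ?_, fun hp => ?_⟩
    · rw [mem_supported'] at hp ⊢
      intro x hx
      refine hp x ?_
      rintro (h | ⟨y, hy, hyx⟩)
      · exact x.2 h
      · exact hx (Subtype.ext hyx ▸ hy)
    · rw [← sub_add_cancel p (extendCompl R T (restrictCompl R T p))]
      exact add_mem (hTW (sub_extendCompl_mem p)) (hext hp)
  have hlift (x : (Tᶜ : Set X)) : ∃ t, x ∈ T' → t ∈ supported R R T ∧
      d t = d (extendCompl R T (ψ (single x 1))) - d (single x.1 1) := by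
    by_cases hx : x ∈ T'
    · have hmem : d (extendCompl R T (ψ (single x 1))) - d (single x.1 1) ∈ supported R R T := by
        rw [← restrictCompl_eq_zero_iff, map_sub, ← extendCompl_single, sub_eq_zero]
        exact hT'.d_φ _ (single_mem_supported R (1 : R) hx)
      obtain ⟨t, ht, hdt⟩ := hT.exact _ hmem (by simp [hd.d_d])
      exact ⟨t, fun _ => ⟨ht, hdt⟩⟩
    · exact ⟨0, fun h => absurd h hx⟩
  choose t ht using hlift
  let φ₁ : (X →₀ R) →ₗ[R] (X →₀ R) := linearCombination R fun x =>
    if hx : x ∈ T then φ (single x 1)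
    else extendCompl R T (ψ (single ⟨x, hx⟩ 1)) - t ⟨x, hx⟩
  have hφ₁ {p} (hp : p ∈ supported R R T) : φ₁ p = φ p :=
    eqOn_supported (fun x hx => by simp [φ₁, hx]) hp
  have hφ₁' (x : (Tᶜ : Set X)) :
      φ₁ (single x.1 1) = extendCompl R T (ψ (single x 1)) - t x := by
    have : x.1 ∉ T := x.2
    simp [φ₁, this]
  have hrφ {p} (hp : p ∈ supported R R W) :
      restrictCompl R T (φ₁ p) = ψ (restrictCompl R T p) := by
    refine eqOn_supported (f := restrictCompl R T ∘ₗ φ₁) (g := ψ ∘ₗ restrictCompl R T) ?_ hp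
    rintro x (hx | ⟨x, hx, rfl⟩)
    · have hx' := single_mem_supported R (1 : R) hx
      simp [hφ₁ hx', restrictCompl_eq_zero_iff.2 hx',
        restrictCompl_eq_zero_iff.2 (hT.map_φ _ hx')]
    · rw [LinearMap.comp_apply, hφ₁', map_sub, restrictCompl_eq_zero_iff.2 (ht x hx).1,
        ← extendCompl_single]
      simp
  have hmap {p} (hp : p ∈ supported R R W) : φ₁ p ∈ supported R R W := by
    rw [hmem, hrφ hp]
    exact hT'.map_φ _ ((hmem p).1 hp)
  have hdφ {p} (hp : p ∈ supported R R W) : d (φ₁ p) = d p := by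
    refine eqOn_supported (f := d ∘ₗ φ₁) (g := d) ?_ hp
    rintro x (hx | ⟨x, hx, rfl⟩)
    · have hx' := single_mem_supported R (1 : R) hx
      simp [hφ₁ hx', hT.d_φ _ hx']
    · simp [hφ₁', (ht x hx).2]
  have hmapd {p} (hp : p ∈ supported R R W) : d p ∈ supported R R W := by
    rw [hmem, ← hT.quotientMap_restrictCompl]
    exact hT'.map_d _ ((hmem p).1 hp)
  refine ⟨φ₁ ∘ₗ φ₁, ⟨fun p hp => hmapd hp, fun p hp hdp => ?_, fun p hp => hmap (hmap hp),
    fun p hp => (hdφ (hmap hp)).trans (hdφ hp), fun p hp => ?_⟩, fun x hx => ?_⟩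
  · obtain ⟨q, hq, hdq⟩ := hT'.exact _ ((hmem p).1 hp)
      (by rw [hT.quotientMap_restrictCompl, hdp, map_zero])
    obtain ⟨r, hr, hdr⟩ := hT.exact (p - d (extendCompl R T q))
      (by rw [← restrictCompl_eq_zero_iff, map_sub, ← hdq, sub_eq_zero]; rfl)
      (by simp [hdp, hd.d_d])
    exact ⟨r + extendCompl R T q, add_mem (hTW hr) (hext hq), by simp [hdr]⟩
  · have hmem' : φ₁ (d p) ∈ supported R R T := by
      rw [← restrictCompl_eq_zero_iff, hrφ (hmapd hp), ← hT.quotientMap_restrictCompl]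
      exact hT'.φ_d _ ((hmem p).1 hp)
    obtain ⟨r, hr, hdr⟩ := hT.exact _ hmem' (by rw [hdφ (hmapd hp), hd.d_d])
    rw [LinearMap.comp_apply, hφ₁ hmem', ← hdr, hT.φ_d _ hr]
  · have hx' := single_mem_supported R (1 : R) hx
    obtain ⟨r, hr, hdr⟩ := hT.exact (φ (single x 1) - single x 1)
      (sub_mem (hT.map_φ _ hx') hx') (by simp [hT.d_φ _ hx'])
    have := hT.φ_d _ hr
    rw [hdr, map_sub, sub_eq_zero] at this
    rw [LinearMap.comp_apply, hφ₁ hx', hφ₁ (hT.map_φ _ hx'), this]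

end IsContraction

/-- A locally split exact differential on a free module is contractible. Zorn's lemma provides a
maximal contractible subcomplex; if it were proper, a countable contractible subcomplex of the
quotient would enlarge it. -/
theorem IsLocallySplitExact.exists_contraction {d : (X →₀ R) →ₗ[R] (X →₀ R)}
    (hd : IsLocallySplitExact d) :
    ∃ φ : (X →₀ R) →ₗ[R] (X →₀ R), (∀ p, d (φ p) = d p) ∧ ∀ p, φ (d p) = 0 := by
  classical
  let r : {a : Set X × ((X →₀ R) →ₗ[R] (X →₀ R)) // IsContraction d a.1 a.2} →
      {a : Set X × ((X →₀ R) →ₗ[R] (X →₀ R)) // IsContraction d a.1 a.2} → Prop := fun a b =>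
    a.1.1 ⊆ b.1.1 ∧ ∀ x ∈ a.1.1, b.1.2 (single x 1) = a.1.2 (single x 1)
  have hub (c) (hc : IsChain r c) : ∃ ub, ∀ a ∈ c, r a ub := by
    let T : Set X := {x | ∃ a ∈ c, x ∈ a.1.1}
    choose f hfc hf using fun x : T => x.2
    let φ : (X →₀ R) →ₗ[R] (X →₀ R) := linearCombination R fun x =>
      if hx : x ∈ T then (f ⟨x, hx⟩).1.2 (single x 1) else 0
    have : Std.Refl r := ⟨fun _ => ⟨subset_rfl, fun _ _ => rfl⟩⟩
    have hφ {a} (ha : a ∈ c) {x} (hx : x ∈ a.1.1) : φ (single x 1) = a.1.2 (single x 1) := by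
      have hxT : x ∈ T := ⟨a, ha, hx⟩
      simp only [φ, linearCombination_single, one_smul, dif_pos hxT]
      rcases hc.total (hfc ⟨x, hxT⟩) ha with h | h
      · exact (h.2 x (hf ⟨x, hxT⟩)).symm
      · exact h.2 x hx
    have hφ' {a} (ha : a ∈ c) {p} (hp : p ∈ supported R R a.1.1) : φ p = a.1.2 p :=
      eqOn_supported (fun x hx => hφ ha hx) hp
    have hle {a} (ha : a ∈ c) : supported R R a.1.1 ≤ supported R R T :=
      supported_mono fun x hx => ⟨a, ha, hx⟩
    by_cases hne : c.Nonempty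
    · have hex {p} (hp : p ∈ supported R R T) : ∃ a ∈ c, p ∈ supported R R a.1.1 := by
        have hfin (s : Finset X) (hs : (s : Set X) ⊆ T) : ∃ a ∈ c, (s : Set X) ⊆ a.1.1 := by
          induction s using Finset.induction_on with
          | empty => exact ⟨_, hne.choose_spec, by simp⟩
          | insert x s _ ih =>
            obtain ⟨a, ha, has⟩ := ih fun y hy => hs (by simp [Finset.mem_coe.1 hy])
            obtain ⟨b, hb, hbx⟩ := hs (Finset.mem_insert_self x s)
            rw [Finset.coe_insert]
            rcases hc.total ha hb with h | h
            · exact ⟨b, hb, Set.insert_subset hbx (has.trans h.1)⟩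
            · exact ⟨a, ha, Set.insert_subset (h.1 hbx) has⟩
        obtain ⟨a, ha, h⟩ := hfin p.support ((mem_supported R p).1 hp)
        exact ⟨a, ha, (mem_supported R p).2 h⟩
      refine ⟨⟨(T, φ), ?_, ?_, ?_, ?_, ?_⟩, fun a ha => ⟨fun x hx => ⟨a, ha, hx⟩,
        fun x hx => hφ ha hx⟩⟩
      all_goals
        intro p hp
        obtain ⟨a, ha, hpa⟩ := hex hp
      · exact hle ha (a.2.map_d _ hpa)
      · intro hdp
        obtain ⟨q, hq, hdq⟩ := a.2.exact _ hpa hdp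
        exact ⟨q, hle ha hq, hdq⟩
      · rw [hφ' ha hpa]
        exact hle ha (a.2.map_φ _ hpa)
      · rw [hφ' ha hpa]
        exact a.2.d_φ _ hpa
      · rw [hφ' ha (a.2.map_d _ hpa)]
        exact a.2.φ_d _ hpa
    · refine ⟨⟨(∅, 0), ?_⟩, fun a ha => absurd ⟨a, ha⟩ hne⟩
      constructor <;> simp [supported_empty]
  obtain ⟨m, hm⟩ := exists_maximal_of_chains_bounded hub fun {a b c} hab hbc =>
    ⟨hab.1.trans hbc.1, fun x hx => (hbc.2 x (hab.1 hx)).trans (hab.2 x hx)⟩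
  have huniv : ∀ x, x ∈ m.1.1 := fun x => by
    by_contra hx
    obtain ⟨T', ψ, hz, hT'⟩ := (IsContraction.isLocallySplitExact_quotientMap hd
      m.2).exists_isContraction_mem ⟨x, hx⟩
    obtain ⟨φ', hφ', hext⟩ := m.2.exists_extension hd hT'
    exact hx ((hm ⟨(_, φ'), hφ'⟩ ⟨Set.subset_union_left, hext⟩).1 (Or.inr ⟨_, hz, rfl⟩))
  have hmem (p : X →₀ R) : p ∈ supported R R m.1.1 := by
    rw [mem_supported]
    exact fun x _ => huniv x
  exact ⟨m.1.2, fun p => m.2.d_φ p (hmem p), fun p => m.2.φ_d p (hmem p)⟩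

end Contraction

/-! ### Strongly compact cardinals -/

section StronglyCompact

open Cardinal Filter

variable {κ : Cardinal.{u}}

/-- If `κ` were singular, a `κ`-complete ultrafilter would be closed under intersections of `κ`
members. An ultrafilter on the power set of a set of cardinality `κ` with this property contains
a singleton, which is impossible if it extends the filter of sets whose complement has cardinality
at most `κ`. -/
theorem IsStronglyCompact.isRegular (hκ : IsStronglyCompact κ) : κ.IsRegular := by
  refine ⟨hκ.aleph0_lt.le, ?_⟩
  by_contra! hcof
  have hIio (s : κ.ord.ToType) : #(Set.Iio s) < κ := by simpa using mk_Iio_lt s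
  let α := κ.ord.ToType
  have hα : #α = κ := mk_ord_toType κ
  have hreg : (Order.succ κ).IsRegular := isRegular_succ hκ.aleph0_lt.le
  let F : Filter (Set α) := cocardinal (Set α) hreg
  have hF : F.NeBot := by
    rw [neBot_iff, ne_eq, ← empty_mem_iff_bot, mem_cocardinal, Set.compl_empty, mk_univ, mk_set,
      hα, Order.lt_succ_iff, not_le]
    exact cantor κ
  obtain ⟨U, hUF, hU⟩ := hκ.exists_ultrafilter _ F hF
    (CardinalInterFilter.of_cardinalInterFilter_of_le F (Order.le_succ κ))
  obtain ⟨S, hS, hSc⟩ := Order.exists_cof_eq α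
  rw [Ordinal.cof_toType] at hSc
  let x₀ : Set α := {a | ∀ᶠ x in (U : Filter (Set α)), a ∈ x}
  have hx₀ (a : α) : ∀ᶠ x in (U : Filter (Set α)), a ∈ x ↔ a ∈ x₀ := by
    by_cases ha : a ∈ x₀
    · exact Filter.Eventually.mono ha fun x hx => ⟨fun _ => ha, fun _ => hx⟩
    · exact (Ultrafilter.eventually_not.2 ha).mono fun x hx =>
        ⟨fun h => absurd h hx, fun h => absurd h ha⟩
  have hall : ∀ᶠ x in (U : Filter (Set α)), ∀ s : S, ∀ a : Set.Iic s.1, (a.1 ∈ x ↔ a.1 ∈ x₀) := by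
    refine (eventually_cardinal_forall (by rwa [hSc])).2 fun s =>
      (eventually_cardinal_forall (c := κ) ?_).2 fun a => hx₀ a
    rw [← Set.Iio_union_right]
    exact (mk_union_le _ _).trans_lt (add_lt_of_lt hκ.aleph0_lt.le ((hIio s.1))
      (by simpa using one_lt_aleph0.trans hκ.aleph0_lt))
  have hsing : ∀ᶠ x in (U : Filter (Set α)), x = x₀ := hall.mono fun x hx => by
    ext a
    obtain ⟨s, hs, has⟩ := hS a
    exact hx ⟨s, hs⟩ ⟨a, has⟩
  have hne : ∀ᶠ x in (U : Filter (Set α)), x ≠ x₀ := hUF (eventually_cocardinal_notMem_of_card_lt (s := {x₀})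
    (by simpa using one_lt_aleph0.trans_le hreg.aleph0_le))
  obtain ⟨x, hx, hx'⟩ := (hsing.and hne).exists
  exact hx' hx

/-- The subsets of `C` of cardinality `< κ` carry a fine `κ`-complete ultrafilter. -/
theorem IsStronglyCompact.exists_fine_ultrafilter (hκ : IsStronglyCompact κ) (C : Type u) :
    ∃ U : Ultrafilter {S : Set C // #S < κ},
      CardinalInterFilter (U : Filter {S : Set C // #S < κ}) κ ∧
      ∀ T : Set C, #T < κ → ∀ᶠ S in (U : Filter {S : Set C // #S < κ}), T ⊆ S.1 := by
  have hreg := hκ.isRegular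
  let I := {S : Set C // #S < κ}
  have hne : Nonempty I := ⟨⟨∅, by simpa using hreg.pos⟩⟩
  have hdir : IsDirectedOrder I := ⟨fun S T => ⟨⟨S.1 ∪ T.1,
    (mk_union_le _ _).trans_lt (add_lt_of_lt hreg.aleph0_le S.2 T.2)⟩,
    Set.subset_union_left, Set.subset_union_right⟩⟩
  obtain ⟨U, hU, hUκ⟩ := hκ.exists_ultrafilter I atTop inferInstance ⟨fun A hA hmem => by
    choose T hT using fun s : A => mem_atTop_sets.1 (hmem s.1 s.2)
    refine mem_atTop_sets.2 ⟨⟨⋃ s, (T s).1, (card_iUnion_lt_iff_forall_of_isRegular hreg hA).2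
      fun s => (T s).2⟩, fun S hS s hs => hT ⟨s, hs⟩ S ?_⟩
    exact (Set.subset_iUnion (fun s => (T s).1) ⟨s, hs⟩).trans hS⟩
  exact ⟨U, hUκ, fun T hT => hU (mem_atTop (⟨T, hT⟩ : I))⟩

theorem Ultrafilter.exists_eventually_eq {I A : Type u} (U : Ultrafilter I)
    [CardinalInterFilter (U : Filter I) κ] (hA : #A < κ) (f : I → A) :
    ∃ a, ∀ᶠ i in (U : Filter _), f i = a := by
  by_contra! h
  have : ∀ᶠ i in (U : Filter _), ∀ a, f i ≠ a :=
    (eventually_cardinal_forall hA).2 fun a => h a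
  obtain ⟨i, hi⟩ := this.exists
  exact hi _ rfl

end StronglyCompact

/-! ### Ultrapowers of free modules -/

section Ultrapower

open Cardinal Filter Finsupp

variable {κ : Cardinal.{u}} {R : Type u} [Ring R] {I : Type u} (U : Ultrafilter I)

/-- A representing function of an element of an ultrapower. -/
noncomputable def germRep {X : Type*} (y : Germ (U : Filter I) X) : I → X := Quotient.out y

@[simp]
theorem coe_germRep {X : Type*} (y : Germ (U : Filter I) X) :
    (germRep U y : Germ (U : Filter I) X) = y := Quotient.out_eq' y

theorem linearCombination_germ_coe {X M : Type*} [AddCommGroup M] [Module R M]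
    (f : X → I → M) (p : X →₀ R) :
    linearCombination R (fun x => ((f x : I → M) : Germ (U : Filter I) M)) p =
      ((fun i => linearCombination R (fun x => f x i) p : I → M) : Germ (U : Filter I) M) := by
  induction p using Finsupp.induction_linear with
  | zero => simp; rfl
  | add p q hp hq => simp only [map_add, hp, hq]; rfl
  | single x r => simp only [linearCombination_single]; rfl

/-- The comparison map from the free module on the ultrapower of `X` to the ultrapower of the free
module on `X`. -/
noncomputable def freeUltrapower (R : Type u) [Ring R] (X : Type u) :
    (Germ (U : Filter I) X →₀ R) →ₗ[R] Germ (U : Filter I) (X →₀ R) :=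
  linearCombination R fun y => ((fun i => single (germRep U y i) 1 : I → X →₀ R) : Germ _ _)

theorem freeUltrapower_apply {X : Type u} (p : Germ (U : Filter I) X →₀ R) :
    freeUltrapower U R X p =
      ((fun i => lmapDomain R R (fun y => germRep U y i) p : I → X →₀ R) : Germ _ _) := by
  rw [freeUltrapower, linearCombination_germ_coe]
  simp [linearCombination_apply, mapDomain]

theorem freeUltrapower_injective (X : Type u) : Function.Injective (freeUltrapower U R X) := by
  rw [injective_iff_map_eq_zero]
  intro p hp
  rw [freeUltrapower_apply] at hp
  have hp' : ∀ᶠ i in (U : Filter _), lmapDomain R R (fun y => germRep U y i) p = 0 := Germ.coe_eq.1 hp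
  have hinj : ∀ᶠ i in (U : Filter _), ∀ y ∈ p.support, ∀ y' ∈ p.support,
      germRep U y i = germRep U y' i → y = y' := by
    refine (eventually_all_finset _).2 fun y _ => (eventually_all_finset _).2 fun y' _ => ?_
    by_cases h : y = y'
    · simp [h]
    · have : ¬ ∀ᶠ i in (U : Filter _), germRep U y i = germRep U y' i := fun h' => by
        have : (germRep U y : Germ (U : Filter I) X) = germRep U y' := Germ.coe_eq.2 h'
        exact h (by simpa using this)
      exact (Ultrafilter.eventually_not.2 this).mono fun i hi h => absurd h hi
  obtain ⟨i, hi, hi'⟩ := (hp'.and hinj).exists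
  ext y
  by_cases hy : y ∈ p.support
  · have := mapDomain_apply' (p.support : Set (Germ (U : Filter I) X)) p subset_rfl
      (f := fun y => germRep U y i) (fun y hy y' hy' => hi' y hy y' hy') hy
    rw [← this]
    exact DFunLike.congr_fun hi _
  · simpa using hy

/-- If `R` has cardinality `< κ` and `U` is `κ`-complete, the ultrapower of a free module is free:
up to `U`-equivalence, the number of terms and the coefficients of a family of formal linear
combinations are constant, and only the basis vectors vary. -/
theorem freeUltrapower_surjective [CardinalInterFilter (U : Filter I) κ] (hκ : ℵ₀ < κ)
    (hR : #R < κ) (X : Type u) : Function.Surjective (freeUltrapower U R X) := by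
  classical
  have key (n : ℕ) : ∀ b : I → X →₀ R, (∀ᶠ i in (U : Filter _), (b i).support.card = n) →
      (b : Germ (U : Filter I) (X →₀ R)) ∈ LinearMap.range (freeUltrapower U R X) := by
    induction n with
    | zero =>
      intro b hb
      have : (b : Germ (U : Filter I) (X →₀ R)) = 0 :=
        Germ.coe_eq.2 (hb.mono fun i hi => by simpa using hi)
      rw [this]
      exact zero_mem _
    | succ n ih =>
      intro b hb
      obtain ⟨i₀, hi₀⟩ := hb.exists
      have hX : Nonempty X := ⟨(Finset.card_pos.1 (by omega : 0 < (b i₀).support.card)).choose⟩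
      let x : I → X := fun i => if h : (b i).support.Nonempty then h.choose else hX.some
      obtain ⟨r, hr⟩ := U.exists_eventually_eq hR fun i => b i (x i)
      have hx : ∀ᶠ i in (U : Filter _), x i ∈ (b i).support := hb.mono fun i hi => by
        have h : (b i).support.Nonempty := Finset.card_pos.1 (by omega)
        simp only [x, dif_pos h]
        exact h.choose_spec
      have h1 := ih (fun i => (b i).erase (x i)) <| by
        filter_upwards [hb, hx] with i hi hxi
        rw [support_erase, Finset.card_erase_of_mem hxi, hi, Nat.add_sub_cancel]
      have h2 : ((fun i => single (x i) r : I → X →₀ R) : Germ (U : Filter I) (X →₀ R)) ∈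
          LinearMap.range (freeUltrapower U R X) := by
        refine ⟨single (x : Germ (U : Filter I) X) r, ?_⟩
        rw [freeUltrapower_apply, Germ.coe_eq]
        have : ∀ᶠ i in (U : Filter _), germRep U (x : Germ (U : Filter I) X) i = x i :=
          Germ.coe_eq.1 (coe_germRep U _)
        exact this.mono fun i hi => by simp [hi]
      have h3 : (b : Germ (U : Filter I) (X →₀ R)) =
          ((fun i => single (x i) r : I → X →₀ R) : Germ (U : Filter I) (X →₀ R)) +
            ((fun i => (b i).erase (x i) : I → X →₀ R) : Germ (U : Filter I) (X →₀ R)) := by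
        rw [← Germ.coe_add, Germ.coe_eq]
        exact hr.mono fun i hi => by
          simp only [Pi.add_apply, ← hi]
          exact (single_add_erase _ _).symm
      rw [h3]
      exact add_mem h2 h1
  intro b
  induction b using Germ.inductionOn with
  | _ b =>
    obtain ⟨n, hn⟩ := U.exists_eventually_eq (κ := κ) (A := ULift.{u} ℕ) (by simpa using hκ)
      fun i => ⟨(b i).support.card⟩
    exact key n.down b (hn.mono fun i hi => congrArg ULift.down hi)

end Ultrapower

/-! ### Pure quotients of free modules -/

section PureQuotient

open Cardinal Filter Finsupp

variable {κ : Cardinal.{u}} {R : Type u} [Ring R]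

theorem LinearMap.exists_comp_eq_of_ker_le {M N P : Type*} [AddCommGroup M] [Module R M]
    [AddCommGroup N] [Module R N] [AddCommGroup P] [Module R P] {p : M →ₗ[R] N}
    (hp : Function.Surjective p) {f : M →ₗ[R] P} (h : LinearMap.ker p ≤ LinearMap.ker f) :
    ∃ f' : N →ₗ[R] P, f' ∘ₗ p = f :=
  ⟨(LinearMap.ker p).liftQ f h ∘ₗ (p.quotKerEquivOfSurjective hp).symm.toLinearMap, by
    ext x
    have : (p.quotKerEquivOfSurjective hp).symm (p x) = (LinearMap.ker p).mkQ x := by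
      rw [LinearEquiv.symm_apply_eq]
      rfl
    simp [this]⟩

theorem map_linearCombination_eq {M N X : Type*} [AddCommGroup M] [Module R M]
    [AddCommGroup N] [Module R N] (g : M →ₗ[R] N) (v : X → M) (p : X →₀ R) :
    g (linearCombination R v p) = linearCombination R (fun x => g (v x)) p := by
  rw [apply_linearCombination]
  rfl

theorem mk_finsupp_lt (hκ : ℵ₀ < κ) (hR : #R < κ) {X : Type u} (hX : #X < κ) :
    #(X →₀ R) < κ := by
  refine (mk_le_of_injective (graph_injective X R)).trans_lt ?_
  rcases finite_or_infinite (X × R) with h | h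
  · exact (lt_aleph0_of_finite _).trans hκ
  · rw [mk_finset_of_infinite, mk_prod, lift_id, lift_id]
    exact mul_lt_of_lt hκ.le hX hR

theorem isLTPresented_of_mk_lt (hκ : ℵ₀ < κ) (hR : #R < κ) {M : Type u} [AddCommGroup M]
    [Module R M] (hM : #M < κ) : IsLTPresented κ R M :=
  ⟨M, linearCombination R id, LinearMap.ker (linearCombination R (id : M → M)), hM,
    (mk_set_le _).trans_lt (mk_finsupp_lt hκ hR hM), fun m => ⟨single m 1, by simp⟩,
    Submodule.span_eq _⟩

theorem isLTPresented_span (hκ : ℵ₀ < κ) (hR : #R < κ) {M : Type u} [AddCommGroup M]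
    [Module R M] {S : Set M} (hS : #S < κ) : IsLTPresented κ R (Submodule.span R S) := by
  refine isLTPresented_of_mk_lt hκ hR (lt_of_le_of_lt ?_ (mk_finsupp_lt hκ hR hS))
  rw [span_eq_range_linearCombination]
  exact mk_le_of_surjective (LinearMap.surjective_rangeRestrict _)

theorem IsPureEpi.comp_of_rightInverse {A B C : Type u} [AddCommGroup A] [Module R A]
    [AddCommGroup B] [Module R B] [AddCommGroup C] [Module R C] {g : B →ₗ[R] C}
    (hg : IsPureEpi κ g) (f : A →ₗ[R] B) (s : B →ₗ[R] A) (hs : f ∘ₗ s = LinearMap.id) :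
    IsPureEpi κ (g ∘ₗ f) where
  surjective := hg.surjective.comp fun b => ⟨s b, LinearMap.congr_fun hs b⟩
  exists_lift M _ _ hM h := by
    obtain ⟨h', rfl⟩ := hg.exists_lift M hM h
    refine ⟨s ∘ₗ h', ?_⟩
    rw [LinearMap.comp_assoc, ← LinearMap.comp_assoc _ s, hs, LinearMap.id_comp]

variable (κ R) in
/-- `C` is a `κ`-pure quotient of a free module. -/
def IsPureQuotientOfFree (C : Type u) [AddCommGroup C] [Module R C] : Prop :=
  ∃ (X : Type u) (g : (X →₀ R) →ₗ[R] C), IsPureEpi κ g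

/-- Finitely many elements of `A` can be retracted back along `i : A → B` at a time. -/
def IsLocallySplitMono {A B : Type*} [AddCommGroup A] [Module R A] [AddCommGroup B] [Module R B]
    (i : A →ₗ[R] B) : Prop :=
  ∀ S : Finset A, ∃ h : B →ₗ[R] A, ∀ a ∈ S, h (i a) = a

theorem IsLocallySplitMono.injective {A B : Type*} [AddCommGroup A] [Module R A] [AddCommGroup B]
    [Module R B] {i : A →ₗ[R] B} (hi : IsLocallySplitMono i) : Function.Injective i := by
  rw [injective_iff_map_eq_zero]
  intro a ha
  obtain ⟨h, hh⟩ := hi {a}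
  rw [← hh a (by simp), ha, map_zero]

/-- A solution in `C` of a system of fewer than `κ` linear equations in fewer than `κ` unknowns lifts
along a `κ`-pure epimorphism to `C`. -/
theorem IsPureEpi.exists_lift_of_relations {B C ι : Type u} [AddCommGroup B] [Module R B]
    [AddCommGroup C] [Module R C] {g : B →ₗ[R] C} (hg : IsPureEpi κ g) (hι : #ι < κ)
    (S : Set (ι →₀ R)) (hS : #S < κ) (f : (ι →₀ R) →ₗ[R] C) (hf : ∀ s ∈ S, f s = 0) :
    ∃ l : (ι →₀ R) →ₗ[R] B, g ∘ₗ l = f ∧ ∀ s ∈ S, l s = 0 := by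
  have hN : Submodule.span R S ≤ LinearMap.ker f := Submodule.span_le.2 hf
  obtain ⟨l, hl⟩ := hg.exists_lift ((ι →₀ R) ⧸ Submodule.span R S)
    ⟨ι, (Submodule.span R S).mkQ, S, hι, hS, Submodule.mkQ_surjective _,
      (Submodule.ker_mkQ _).symm⟩ ((Submodule.span R S).liftQ f hN)
  refine ⟨l ∘ₗ (Submodule.span R S).mkQ, ?_, fun s hs => ?_⟩
  · rw [← LinearMap.comp_assoc, hl, Submodule.liftQ_mkQ]
  · rw [LinearMap.comp_apply, Submodule.mkQ_apply,
      (Submodule.Quotient.mk_eq_zero _).2 (Submodule.subset_span hs), map_zero]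

/-- Fewer than `κ` elements of the kernel of a `κ`-pure epimorphism `g` from a free module lie in
the span of fewer than `κ` basis vectors. The quotient of this span by these elements is
`<κ`-presented, and a lift through `g` of the map it induces differs from the identity by a
retraction onto the kernel. -/
theorem IsPureEpi.exists_retraction_ker (hκ : κ.IsRegular) {C X : Type u} [AddCommGroup C]
    [Module R C] {g : (X →₀ R) →ₗ[R] C} (hg : IsPureEpi κ g) (S : Set (LinearMap.ker g))
    (hS : #S < κ) :
    ∃ h : (X →₀ R) →ₗ[R] LinearMap.ker g, ∀ a ∈ S, h a.1 = a := by
  classical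
  let T : Set X := ⋃ a : S, (a.1.1.support : Set X)
  have hT : #T < κ := (card_iUnion_lt_iff_forall_of_isRegular hκ hS).2 fun a =>
    (lt_aleph0_of_finite _).trans_le hκ.aleph0_le
  obtain ⟨res, ext, hext⟩ : ∃ (res : (X →₀ R) →ₗ[R] (T →₀ R)) (ext : (T →₀ R) →ₗ[R] (X →₀ R)),
      ∀ a ∈ S, ext (res a.1) = a.1 := by
    refine ⟨lsubtypeDomain T, lmapDomain R R Subtype.val, fun a ha => ?_⟩
    ext x
    by_cases hx : x ∈ T
    · exact mapDomain_apply Subtype.val_injective (lsubtypeDomain T a.1) ⟨x, hx⟩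
    · rw [lmapDomain_apply, mapDomain_of_notMem_range _ _ (by simpa using hx), eq_comm, ← notMem_support_iff]
      exact fun h => hx (Set.mem_iUnion.2 ⟨⟨a, ha⟩, h⟩)
  obtain ⟨l, hl, hl0⟩ := hg.exists_lift_of_relations hT ((fun a => res a.1) '' S)
    (mk_image_le.trans_lt hS) (g ∘ₗ ext) (by
      rintro _ ⟨a, ha, rfl⟩
      rw [LinearMap.comp_apply, hext a ha]
      exact a.2)
  have hker (p) : (ext - l) p ∈ LinearMap.ker g := by
    have := LinearMap.congr_fun hl p
    simp only [LinearMap.comp_apply] at this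
    simp [this]
  refine ⟨(LinearMap.codRestrict _ _ hker) ∘ₗ res, fun a ha => Subtype.ext ?_⟩
  simp only [LinearMap.comp_apply, LinearMap.codRestrict_apply, LinearMap.sub_apply,
    hl0 _ ⟨a, ha, rfl⟩, sub_zero]
  exact hext a ha

/-- The kernel of a `κ`-pure epimorphism from a free module is again a `κ`-pure quotient of a free
module: a map from a `<κ`-presented module to the kernel factors through the free module. -/
theorem IsPureEpi.isPureQuotientOfFree_ker (hκ : κ.IsRegular) {C X : Type u} [AddCommGroup C]
    [Module R C] {g : (X →₀ R) →ₗ[R] C} (hg : IsPureEpi κ g) :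
    IsPureQuotientOfFree κ R (LinearMap.ker g) := by
  have hsurj : Function.Surjective (linearCombination R (id : LinearMap.ker g → _)) :=
    fun m => ⟨single m 1, by simp⟩
  refine ⟨LinearMap.ker g, linearCombination R id, hsurj, fun M _ _ hM f => ?_⟩
  obtain ⟨ι, p, _, hι, _, hp, _⟩ := hM
  obtain ⟨h, hh⟩ := hg.exists_retraction_ker hκ (Set.range fun k : ι => f (p (single k 1)))
    (mk_range_le.trans_lt hι)
  obtain ⟨h', hh'⟩ := Module.projective_lifting_property _ h hsurj
  refine ⟨h' ∘ₗ (LinearMap.ker g).subtype ∘ₗ f, ?_⟩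
  rw [← LinearMap.comp_assoc, hh']
  refine (LinearMap.cancel_right hp).1 ?_
  ext k : 2
  simpa using congrArg Subtype.val (hh _ ⟨k, rfl⟩)

/-- A `κ`-pure quotient `C` of a free module `B` embeds in an ultrapower of `B`: over a subset `S`
of `C` of cardinality `< κ` there is a section to `B`, and these sections assemble to a map into the
ultrapower with respect to a fine `κ`-complete ultrafilter. The embedding is locally split and its
cokernel is again a `κ`-pure quotient of a free module, since both properties only involve fewer
than `κ` equations, which can be tested at a single index. -/
theorem IsPureQuotientOfFree.exists_embedding (hκ : IsStronglyCompact κ) (hR : #R < κ) {C : Type u}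
    [AddCommGroup C] [Module R C] (hC : IsPureQuotientOfFree κ R C) :
    ∃ (X : Type u) (i : C →ₗ[R] (X →₀ R)), IsLocallySplitMono i ∧
      IsPureEpi κ (LinearMap.range i).mkQ := by
  classical
  obtain ⟨X, g, hg⟩ := hC
  obtain ⟨U, hU, hfine⟩ := hκ.exists_fine_ultrafilter C
  let I := {S : Set C // #S < κ}
  have hsec (S : I) : ∃ s : Submodule.span R S.1 →ₗ[R] (X →₀ R),
      g ∘ₗ s = (Submodule.span R S.1).subtype := by
    refine hg.exists_lift _ (isLTPresented_span hκ.aleph0_lt hR S.2) _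
  choose s hs using hsec
  let σ : C → I → (X →₀ R) := fun c S => if h : c ∈ Submodule.span R S.1 then s S ⟨c, h⟩ else 0
  have hσ {S : I} {c : C} (h : c ∈ Submodule.span R S.1) : σ c S = s S ⟨c, h⟩ := dif_pos h
  have hgσ {S : I} {c : C} (h : c ∈ Submodule.span R S.1) : g (σ c S) = c := by
    rw [hσ h]
    exact LinearMap.congr_fun (hs S) ⟨c, h⟩
  have hmem (c : C) : ∀ᶠ S in (U : Filter I), c ∈ Submodule.span R S.1 :=
    (hfine {c} (by simpa using one_lt_aleph0.trans hκ.aleph0_lt)).mono fun S hS =>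
      Submodule.subset_span (hS rfl)
  let i₀ : C →ₗ[R] Germ (U : Filter I) (X →₀ R) :=
    { toFun := fun c => (σ c : Germ (U : Filter I) (X →₀ R))
      map_add' := fun c c' => by
        rw [← Germ.coe_add, Germ.coe_eq]
        filter_upwards [hmem c, hmem c'] with S h h'
        change σ (c + c') S = σ c S + σ c' S
        rw [hσ (add_mem h h'), hσ h, hσ h', ← map_add]
        rfl
      map_smul' := fun r c => by
        rw [RingHom.id_apply, ← Germ.coe_smul, Germ.coe_eq]
        filter_upwards [hmem c] with S h
        change σ (r • c) S = r • σ c S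
        rw [hσ (Submodule.smul_mem _ r h), hσ h, ← map_smul]
        rfl }
  let e : (Germ (U : Filter I) X →₀ R) ≃ₗ[R] Germ (U : Filter I) (X →₀ R) :=
    LinearEquiv.ofBijective (freeUltrapower U R X) ⟨freeUltrapower_injective U X,
      freeUltrapower_surjective U hκ.aleph0_lt hR X⟩
  let i : C →ₗ[R] (Germ (U : Filter I) X →₀ R) := e.symm.toLinearMap ∘ₗ i₀
  have hei (c : C) : freeUltrapower U R X (i c) = (σ c : Germ (U : Filter I) (X →₀ R)) :=
    e.apply_symm_apply (i₀ c)
  refine ⟨Germ (U : Filter I) X, i, fun T => ?_, Submodule.mkQ_surjective _, fun M _ _ hM f => ?_⟩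
  · have h1 (c : C) : ∀ᶠ S in (U : Filter I),
        lmapDomain R R (fun y => germRep U y S) (i c) = σ c S := by
      have := hei c
      rw [freeUltrapower_apply] at this
      exact Germ.coe_eq.1 this
    obtain ⟨S, hS⟩ := ((eventually_all_finset T).2 fun c _ => (h1 c).and (hmem c)).exists
    refine ⟨g ∘ₗ lmapDomain R R (fun y => germRep U y S), fun c hc => ?_⟩
    rw [LinearMap.comp_apply, (hS c hc).1, hgσ (hS c hc).2]
  · obtain ⟨ι, p, rel, _, hrel, hp, hker⟩ := hM
    choose b hb using fun k : ι => Submodule.mkQ_surjective (LinearMap.range i) (f (p (single k 1)))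
    have hlin (q : ι →₀ R) : (LinearMap.range i).mkQ (linearCombination R b q) = f (p q) := by
      refine LinearMap.congr_fun
        (f := (LinearMap.range i).mkQ ∘ₗ linearCombination R b) (g := f ∘ₗ p) ?_ q
      ext k
      simpa using hb k
    have hrel0 (q : rel) : ∃ c, i c = linearCombination R b q.1 := by
      have h0 : p q.1 = 0 := hker.le (Submodule.subset_span q.2)
      have := hlin q.1
      rw [h0, map_zero, Submodule.mkQ_apply, Submodule.Quotient.mk_eq_zero] at this
      exact this
    choose c hc using hrel0
    let β : ι → I → (X →₀ R) := fun k => germRep U (freeUltrapower U R X (b k))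
    have hβ (q : rel) : ∀ᶠ S in (U : Filter I),
        linearCombination R (fun k => β k S) q.1 = σ (c q) S := by
      have := hei (c q)
      rw [hc, map_linearCombination_eq] at this
      have h2 : (fun k => freeUltrapower U R X (b k)) =
          fun k => ((β k : I → X →₀ R) : Germ (U : Filter I) (X →₀ R)) := by
        ext k
        exact (coe_germRep U _).symm
      rw [h2, linearCombination_germ_coe] at this
      exact Germ.coe_eq.1 this
    obtain ⟨S, hS⟩ := ((eventually_cardinal_forall (c := κ) hrel).2
      fun q => (hβ q).and (hmem (c q))).exists
    -- At the index `S` the equations `q = i (c q)` hold in the free module on `X`; applying `g` solves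
    -- them in `C`, which corrects the lifts `b` by elements of the range of `i`.
    let γ : (ι →₀ R) →ₗ[R] C := linearCombination R fun k => g (β k S)
    have hγ (q : rel) : γ q.1 = c q := by
      rw [← hgσ (hS q).2, ← (hS q).1, map_linearCombination_eq]
    obtain ⟨f', hf'⟩ := LinearMap.exists_comp_eq_of_ker_le hp
      (f := linearCombination R b - i ∘ₗ γ) (by
        rw [← hker, Submodule.span_le]
        intro q hq
        have := hγ ⟨q, hq⟩
        simp only at this
        simp [this, hc])
    refine ⟨f', (LinearMap.cancel_right hp).1 ?_⟩
    rw [LinearMap.comp_assoc, hf']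
    ext k : 2
    have h0 : (LinearMap.range i).mkQ (i (γ (single k 1))) = 0 :=
      (Submodule.Quotient.mk_eq_zero _).2 ⟨_, rfl⟩
    simp only [LinearMap.comp_apply, lsingle_apply, LinearMap.sub_apply, map_sub, h0,
      linearCombination_single, one_smul, hb, sub_zero]

end PureQuotient

/-! ### Pure quotients of free modules are projective -/

section Projective

open Cardinal Finsupp

variable {κ : Cardinal.{u}} {R : Type u} [Ring R]

/-- A module which is a locally split submodule of a free module, with a quotient isomorphic to
itself, is projective: the composite of the quotient map and the embedding is a locally split
exact differential. -/
theorem projective_of_isLocallySplitMono_of_exact {Z X : Type*} [AddCommGroup Z] [Module R Z]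
    {i : Z →ₗ[R] (X →₀ R)} {q : (X →₀ R) →ₗ[R] Z} (hi : IsLocallySplitMono i)
    (hiq : Function.Exact i q) (hq : Function.Surjective q) : Module.Projective R Z := by
  classical
  have hd0 (p) : (i ∘ₗ q) p = 0 ↔ q p = 0 := map_eq_zero_iff i hi.injective
  have hd : IsLocallySplitExact (i ∘ₗ q) := by
    refine ⟨fun p => ?_, fun S => ?_⟩
    · rw [hd0, hiq p]
      refine ⟨?_, fun ⟨p', hp'⟩ => ⟨q p', hp'⟩⟩
      rintro ⟨z, rfl⟩
      obtain ⟨p', rfl⟩ := hq z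
      exact ⟨p', rfl⟩
    · obtain ⟨h, hh⟩ := hi (S.image fun x => q (single x 1))
      obtain ⟨h', rfl⟩ := Module.projective_lifting_property q h hq
      exact ⟨h', fun x hx => congrArg i (hh _ (Finset.mem_image_of_mem _ hx))⟩
  obtain ⟨φ, hφ, hφd⟩ := hd.exists_contraction
  have hrange (p : X →₀ R) : (LinearMap.id - φ : (X →₀ R) →ₗ[R] (X →₀ R)) p ∈ LinearMap.range i := by
    refine (hiq _).1 ((hd0 _).1 ?_)
    rw [LinearMap.sub_apply, map_sub, hφ, LinearMap.id_apply, sub_self]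
  refine Module.Projective.of_split i
    ((LinearEquiv.ofInjective i hi.injective).symm.toLinearMap ∘ₗ
      LinearMap.codRestrict _ _ hrange) ?_
  ext z
  rw [LinearMap.comp_apply, LinearMap.comp_apply, LinearEquiv.coe_coe, LinearEquiv.symm_apply_eq]
  obtain ⟨p, rfl⟩ := hq z
  ext1
  have := hφd p
  simp only [LinearMap.comp_apply] at this
  simp [this]

/-- `A` is a locally split submodule of a free module with quotient `N`. -/
def IsFreeExtension (A N : ModuleCat.{u} R) : Prop :=
  ∃ (X : Type u) (i : A →ₗ[R] (X →₀ R)) (q : (X →₀ R) →ₗ[R] N),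
    IsLocallySplitMono i ∧ Function.Exact i q ∧ Function.Surjective q

theorem exists_int_chain {α : Type*} {r : α → α → Prop} (hr : ∀ a, ∃ b, r a b)
    (hl : ∀ b, ∃ a, r a b) (c : α) : ∃ f : ℤ → α, f 0 = c ∧ ∀ k, r (f k) (f (k + 1)) := by
  choose right hright using hr
  choose left hleft using hl
  refine ⟨fun k => match k with
    | .ofNat n => right^[n] c
    | .negSucc n => left^[n + 1] c, rfl, fun k => ?_⟩
  match k with
  | .ofNat n =>
    change r (right^[n] c) (right^[n + 1] c)
    rw [Function.iterate_succ_apply']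
    exact hright _
  | .negSucc 0 => exact hleft c
  | .negSucc (n + 1) =>
    change r (left^[n + 1 + 1] c) (left^[n + 1] c)
    rw [Function.iterate_succ_apply' _ (n + 1)]
    exact hleft _

/-- A module in a two-sided sequence of modules, each of which is a locally split submodule of
a free module with quotient the next one, is projective. The direct sum of the sequence satisfies
the hypotheses of `projective_of_isLocallySplitMono_of_exact`. -/
theorem projective_of_isFreeExtension (f : ℤ → ModuleCat.{u} R)
    (hf : ∀ k, IsFreeExtension (f k) (f (k + 1))) : Module.Projective R (f 0) := by
  classical
  choose X i q hi hiq hq using hf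
  let e : ((Σ k, X k) →₀ R) ≃ₗ[R] Π₀ k, (X k →₀ R) := sigmaFinsuppLequivDFinsupp R
  -- `E` shifts the degree by one.
  let E : (Π₀ k, f (k + 1)) ≃ₗ[R] Π₀ k, f k :=
    (DirectSum.lequivCongrLeft R (M := fun k => f k) (Equiv.addRight (1 : ℤ)).symm).symm
  let i' : (Π₀ k, f k) →ₗ[R] Π₀ k, (X k →₀ R) := DFinsupp.mapRange.linearMap i
  let q' : (Π₀ k, (X k →₀ R)) →ₗ[R] Π₀ k, f (k + 1) := DFinsupp.mapRange.linearMap q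
  have hi' (k z) : i' z k = i k (z k) := rfl
  have hq' (k p) : q' p k = q k (p k) := rfl
  have hsplit : IsLocallySplitMono (e.symm.toLinearMap ∘ₗ i') := fun S => by
    choose h hh using fun k => hi k (S.image fun z => z k)
    refine ⟨DFinsupp.mapRange.linearMap h ∘ₗ e.toLinearMap, fun z hz => ?_⟩
    ext k
    simpa [hi'] using hh k _ (Finset.mem_image_of_mem _ hz)
  have hexact : Function.Exact (e.symm.toLinearMap ∘ₗ i')
      (E.toLinearMap ∘ₗ q' ∘ₗ e.toLinearMap) := by
    intro p
    simp only [LinearMap.comp_apply, LinearEquiv.coe_coe, Set.mem_range,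
      map_eq_zero_iff E E.injective, LinearEquiv.symm_apply_eq]
    refine ⟨fun hp => ?_, fun ⟨z, hz⟩ => ?_⟩
    · refine ⟨DFinsupp.mapRange (fun k => Function.invFun (i k)) (fun k => ?_) (e p), ?_⟩
      · rw [← map_zero (i k)]
        exact Function.leftInverse_invFun (hi k).injective 0
      · ext1 k
        obtain ⟨z, hz⟩ := (hiq k (e p k)).1 (DFunLike.congr_fun hp k)
        rw [hi', DFinsupp.mapRange_apply, ← hz, Function.leftInverse_invFun (hi k).injective]
    · ext1 k
      rw [← hz, hq', hi']
      exact (hiq k).apply_apply_eq_zero _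
  have hsurj : Function.Surjective (E.toLinearMap ∘ₗ q' ∘ₗ e.toLinearMap) := by
    have hq'_surj : Function.Surjective q' :=
      (DFinsupp.mapRange_surjective _ fun k => map_zero (q k)).2 hq
    exact E.surjective.comp (hq'_surj.comp e.surjective)
  have := projective_of_isLocallySplitMono_of_exact hsplit hexact hsurj
  refine Module.Projective.of_split (DFinsupp.lsingle (M := fun k => f k) 0)
    (DFinsupp.lapply (R := R) (M := fun k => f k) 0) ?_
  ext z
  simp

/-- Iterated cokernels of embeddings and kernels of presentations place `C` in a two-sided sequence
of locally split extensions by free modules. -/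
theorem IsPureQuotientOfFree.projective (hκ : IsStronglyCompact κ) (hR : #R < κ) {C : Type u}
    [AddCommGroup C] [Module R C] (hC : IsPureQuotientOfFree κ R C) : Module.Projective R C := by
  let r : {M : ModuleCat.{u} R // IsPureQuotientOfFree κ R M} →
      {M : ModuleCat.{u} R // IsPureQuotientOfFree κ R M} → Prop :=
    fun A N => IsFreeExtension A.1 N.1
  have hr (A) : ∃ N, r A N := by
    obtain ⟨X, i, hi, hpure⟩ := A.2.exists_embedding hκ hR
    exact ⟨⟨ModuleCat.of R ((X →₀ R) ⧸ LinearMap.range i), X, _, hpure⟩, X, i,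
      (LinearMap.range i).mkQ, hi, LinearMap.exact_map_mkQ_range i, Submodule.mkQ_surjective _⟩
  have hl (N) : ∃ A, r A N := by
    obtain ⟨X, g, hg⟩ := N.2
    refine ⟨⟨ModuleCat.of R (LinearMap.ker g), hg.isPureQuotientOfFree_ker hκ.isRegular⟩, X,
      (LinearMap.ker g).subtype, g, fun S => ?_, LinearMap.exact_subtype_ker_map g, hg.surjective⟩
    exact hg.exists_retraction_ker hκ.isRegular (S : Set (LinearMap.ker g))
      ((lt_aleph0_of_finite _).trans hκ.aleph0_lt)
  obtain ⟨f, hf0, hf⟩ := exists_int_chain hr hl ⟨ModuleCat.of R C, hC⟩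
  have := projective_of_isFreeExtension (fun k => (f k).1) hf
  rwa [hf0] at this

theorem IsPureEpi.projective (hκ : IsStronglyCompact κ) (hR : #R < κ) {B C : Type u}
    [AddCommGroup B] [Module R B] [AddCommGroup C] [Module R C] [Module.Projective R B]
    {g : B →ₗ[R] C} (hg : IsPureEpi κ g) : Module.Projective R C := by
  obtain ⟨s, hs⟩ := Module.projective_def'.1 ‹Module.Projective R B›
  exact IsPureQuotientOfFree.projective hκ hR ⟨B, _, hg.comp_of_rightInverse _ s hs⟩

end Projective

/-! ### The category of projective modules -/

section Category

open Cardinal Finsupp Limits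

variable {κ : Cardinal.{u}} {R : Type u} [Ring R]

/-- The colimit of a `κ`-filtered diagram of modules is a `κ`-pure quotient of the direct sum of
the diagram: generators of a `<κ`-presented module lift to some stage, and their relations
hold at a later stage. -/
theorem isPureEpi_toModule_of_isColimit [Fact κ.IsRegular] {J : Type u} [SmallCategory J]
    [DecidableEq J] [IsCardinalFiltered J κ] {F : J ⥤ ModuleCat.{u} R} {c : Cocone F}
    (hc : IsColimit c) :
    IsPureEpi κ (DirectSum.toModule R J c.pt fun j => (c.ι.app j).hom) := by
  have := isFiltered_of_isCardinalFiltered J κ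
  have hc' := isColimitOfPreserves (forget (ModuleCat.{u} R)) hc
  have hsurj (x : c.pt) : ∃ (j : J) (y : F.obj j), (c.ι.app j).hom y = x :=
    Types.jointly_surjective_of_isColimit hc' x
  have hzero {j : J} (y : F.obj j) (hy : (c.ι.app j).hom y = 0) :
      ∃ (k : J) (a : j ⟶ k), (F.map a).hom y = 0 := by
    obtain ⟨k, a, ha⟩ := (Types.FilteredColimit.isColimit_eq_iff' hc' y (0 : F.obj j)).1
      (hy.trans (map_zero (c.ι.app j).hom).symm)
    exact ⟨k, a, ha.trans (map_zero (F.map a).hom)⟩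
  have hw {j k : J} (a : j ⟶ k) (y : F.obj j) :
      (c.ι.app k).hom ((F.map a).hom y) = (c.ι.app j).hom y := by
    rw [← c.w a]
    rfl
  refine ⟨fun x => ?_, fun M _ _ hM f => ?_⟩
  · obtain ⟨j, y, rfl⟩ := hsurj x
    exact ⟨DirectSum.lof R J (fun j => F.obj j) j y, by simp⟩
  · obtain ⟨ι, p, S, hι, hS, hp, hker⟩ := hM
    rw [← hasCardinalLT_iff_cardinal_mk_lt] at hι hS
    choose j y hy using fun k : ι => hsurj (f (p (single k 1)))
    let m : J := IsCardinalFiltered.max j hι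
    let l : (ι →₀ R) →ₗ[R] F.obj m :=
      linearCombination R fun k => (F.map (IsCardinalFiltered.toMax j hι k)).hom (y k)
    have hl : (c.ι.app m).hom ∘ₗ l = f ∘ₗ p := by
      ext k : 2
      simp [l, hw, hy]
    have hrel (s : S) : ∃ (k : J) (a : m ⟶ k), (F.map a).hom (l s.1) = 0 := by
      refine hzero _ ?_
      have h0 : p s.1 = 0 := hker.le (Submodule.subset_span s.2)
      have := LinearMap.congr_fun hl s.1
      simpa [h0] using this
    choose k a ha using hrel
    obtain ⟨n, b, d, hbd⟩ := IsCardinalFiltered.wideSpan a hS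
    obtain ⟨f', hf'⟩ := LinearMap.exists_comp_eq_of_ker_le hp (f := (F.map d).hom ∘ₗ l) (by
      rw [← hker, Submodule.span_le]
      intro s hs
      change (F.map d).hom (l s) = 0
      rw [← hbd ⟨s, hs⟩, F.map_comp, ModuleCat.hom_comp, LinearMap.comp_apply, ha, map_zero])
    refine ⟨DirectSum.lof R J (fun j => F.obj j) n ∘ₗ f', (LinearMap.cancel_right hp).1 ?_⟩
    rw [LinearMap.comp_assoc, LinearMap.comp_assoc, hf', ← hl]
    ext k : 2
    simp [hw]

theorem isClosedUnderColimitsOfShape_projective [Fact κ.IsRegular] (hκ : IsStronglyCompact κ)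
    (hR : #R < κ) (J : Type u) [SmallCategory J] [IsCardinalFiltered J κ] :
    ObjectProperty.IsClosedUnderColimitsOfShape
      (fun M : ModuleCat.{u} R => Module.Projective R M) J where
  colimitsOfShape_le X := by
    classical
    rintro ⟨h⟩
    have hproj := h.prop_diag_obj
    exact (isPureEpi_toModule_of_isColimit (κ := κ) h.isColimit).projective hκ hR

/-- The free module on `X`, as an object of the category of projective modules. -/
noncomputable abbrev freeObj (R : Type u) [Ring R] (X : Type u) : ProjectiveModuleCat R :=
  ⟨ModuleCat.of R (X →₀ R), (inferInstance : Module.Projective R (X →₀ R))⟩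

theorem isCardinalPresentable_freeObj [Fact κ.IsRegular] (hκ : IsStronglyCompact κ) (hR : #R < κ)
    {X : Type u} (hX : #X < κ) : IsCardinalPresentable (freeObj R X) κ where
  preservesColimitOfShape J _ _ := ⟨fun {F} => ⟨fun {c} hc => ⟨by
    have := isFiltered_of_isCardinalFiltered J κ
    have := isClosedUnderColimitsOfShape_projective hκ hR J
    have hX' : HasCardinalLT X κ := by rwa [hasCardinalLT_iff_cardinal_mk_lt]
    have hc' := isColimitOfPreserves (ObjectProperty.ι _ ⋙ forget (ModuleCat.{u} R)) hc
    refine Types.FilteredColimit.isColimitOf' _ _ (fun f => ?_) (fun j f g h => ?_)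
    · have hsurj (x : c.pt.obj) : ∃ (j : J) (y : (F.obj j).obj), (c.ι.app j).hom.hom y = x :=
        Types.jointly_surjective_of_isColimit hc' x
      let f₀ : (X →₀ R) →ₗ[R] c.pt.obj := f.hom.hom
      choose j y hy using fun x : X => hsurj (f₀ (single x 1))
      let l : (X →₀ R) →ₗ[R] (F.obj (IsCardinalFiltered.max j hX')).obj :=
        linearCombination R fun x => (F.map (IsCardinalFiltered.toMax j hX' x)).hom.hom (y x)
      refine ⟨_, ObjectProperty.homMk (ModuleCat.ofHom l), ?_⟩
      refine ObjectProperty.hom_ext _ (ModuleCat.hom_ext ?_)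
      change f₀ = (c.ι.app _).hom.hom ∘ₗ l
      ext x : 2
      have hw := c.w (IsCardinalFiltered.toMax j hX' x)
      have hw' := LinearMap.congr_fun (congrArg (fun t => t.hom.hom) hw) (y x)
      simp only [LinearMap.comp_apply, lsingle_apply, l, linearCombination_single, one_smul,
        ← hy x]
      exact hw'.symm
    · let f₀ : (X →₀ R) →ₗ[R] (F.obj j).obj := f.hom.hom
      let g₀ : (X →₀ R) →ₗ[R] (F.obj j).obj := g.hom.hom
      have h₀ : (c.ι.app j).hom.hom ∘ₗ f₀ = (c.ι.app j).hom.hom ∘ₗ g₀ :=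
        congrArg (fun t => t.hom.hom) h
      have hx (x : X) : ∃ (k : J) (a : j ⟶ k),
          (F.map a).hom.hom (f₀ (single x 1)) = (F.map a).hom.hom (g₀ (single x 1)) :=
        (Types.FilteredColimit.isColimit_eq_iff' hc' _ _).1 (LinearMap.congr_fun h₀ (single x 1))
      choose k a ha using hx
      obtain ⟨n, b, d, hbd⟩ := IsCardinalFiltered.wideSpan a hX'
      refine ⟨n, d, ?_⟩
      refine ObjectProperty.hom_ext _ (ModuleCat.hom_ext ?_)
      change (F.map d).hom.hom ∘ₗ f₀ = (F.map d).hom.hom ∘ₗ g₀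
      ext x : 2
      have hd : (F.map d).hom.hom = (F.map (b x)).hom.hom ∘ₗ (F.map (a x)).hom.hom := by
        rw [← hbd x, F.map_comp]
        rfl
      simp only [LinearMap.comp_apply, lsingle_apply, hd, ha x]⟩⟩⟩

variable (κ R) in
/-- The free modules on the subsets of cardinality `< κ` of a fixed set of cardinality `κ`. -/
noncomputable def smallFree : ObjectProperty (ProjectiveModuleCat R) :=
  ObjectProperty.ofObj fun s : {s : Set κ.out // #s < κ} => freeObj R s.1

theorem retractClosure_smallFree_freeObj {X : Type u} (hX : #X < κ) :
    (smallFree κ R).retractClosure (freeObj R X) := by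
  have hX' := hX.le
  rw [← mk_out κ, le_def] at hX'
  obtain ⟨f⟩ := hX'
  let e : X ≃ Set.range f := Equiv.ofInjective f f.injective
  have hs : #(Set.range f) < κ := (mk_congr e.symm).trans_lt hX
  let E := Finsupp.domLCongr (M := R) (R := R) e
  have hmem : smallFree κ R (freeObj R (Set.range f)) := ObjectProperty.ofObj_apply
    (fun s : {s : Set κ.out // #s < κ} => freeObj R s.1) ⟨Set.range f, hs⟩
  refine ⟨freeObj R (Set.range f), hmem, ⟨⟨
    ObjectProperty.homMk (ModuleCat.ofHom E.toLinearMap),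
    ObjectProperty.homMk (ModuleCat.ofHom E.symm.toLinearMap), ?_⟩⟩⟩
  ext : 2
  exact LinearMap.ext fun x => E.symm_apply_apply x

/-- The sets of generators of cardinality `< κ` that are stable under a section `s` of the canonical
presentation of a projective module. -/
abbrev StableSet (κ : Cardinal.{u}) {M : Type u} [AddCommGroup M] [Module R M]
    (s : M →ₗ[R] (M →₀ R)) : Type u :=
  {Y : Set M // #Y < κ ∧ ∀ y ∈ Y, s y ∈ supported R R Y}

section StableSet

variable {M : Type u} [AddCommGroup M] [Module R M] {s : M →ₗ[R] (M →₀ R)}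

/-- The direct summand of the free module on `Y` cut out by `s`, as a submodule of `M`. -/
noncomputable def StableSet.submodule (Y : StableSet κ s) : Submodule R M := (supported R R Y.1).comap s

theorem StableSet.submodule_mono {Y Z : StableSet κ s} (h : Y ≤ Z) :
    Y.submodule ≤ Z.submodule := Submodule.comap_mono (supported_mono h)

theorem StableSet.exists_retract (hs : linearCombination R id ∘ₗ s = LinearMap.id)
    (Y : StableSet κ s) : ∃ (i : Y.submodule →ₗ[R] (Y.1 →₀ R)) (r : (Y.1 →₀ R) →ₗ[R] Y.submodule),
      r ∘ₗ i = LinearMap.id := by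
  let e := supportedEquivFinsupp (M := R) (R := R) Y.1
  let i₀ : Y.submodule →ₗ[R] supported R R Y.1 := s.restrict fun _ h => h
  let r₀ : supported R R Y.1 →ₗ[R] Y.submodule :=
    (linearCombination R (id : M → M)).restrict fun p hp => by
      refine supported_le_of_single_mem
        (N := Y.submodule.comap (linearCombination R (id : M → M))) (fun y hy => ?_) hp
      have : y ∈ Y.submodule := Y.2.2 y hy
      simpa using this
  refine ⟨e.toLinearMap ∘ₗ i₀, r₀ ∘ₗ e.symm.toLinearMap, ?_⟩
  ext m
  have := LinearMap.congr_fun hs m.1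
  change linearCombination R id (e.symm (e (i₀ m))).1 = m.1
  rw [e.symm_apply_apply]
  exact this

theorem StableSet.isCardinalFiltered [hκ : Fact κ.IsRegular] :
    IsCardinalFiltered (StableSet κ s) κ :=
  isCardinalFiltered_preorder _ _ fun K Y hK =>
    ⟨⟨⋃ k, (Y k).1, (card_iUnion_lt_iff_forall_of_isRegular hκ.out hK).2 fun k => (Y k).2.1,
      fun y hy => by
        obtain ⟨k, hk⟩ := Set.mem_iUnion.1 hy
        exact supported_mono (Set.subset_iUnion (fun k => (Y k).1) k) ((Y k).2.2 y hk)⟩,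
      fun k => Set.subset_iUnion (fun k => (Y k).1) k⟩

theorem StableSet.exists_mem_submodule (hκ : ℵ₀ < κ) (m : M) :
    ∃ Y : StableSet κ s, m ∈ Y.submodule := by
  classical
  let A : ℕ → Finset M := fun n =>
    (fun B => B ∪ B.biUnion fun y => (s y).support)^[n] (s m).support
  have hA (n) : A (n + 1) = A n ∪ (A n).biUnion fun y => (s y).support :=
    Function.iterate_succ_apply' _ _ _
  refine ⟨⟨⋃ n, (A n : Set M), ?_, fun y hy => ?_⟩, ?_⟩
  · exact (mk_le_aleph0_iff.2
      (Set.countable_iUnion fun n => (A n).countable_toSet).to_subtype).trans_lt hκ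
  · obtain ⟨n, hn⟩ := Set.mem_iUnion.1 hy
    rw [mem_supported]
    refine Set.Subset.trans (fun z hz => ?_) (Set.subset_iUnion (fun n => (A n : Set M)) (n + 1))
    rw [hA]
    exact Finset.mem_coe.2 (Finset.mem_union_right _ (Finset.mem_biUnion.2 ⟨y, hn, hz⟩))
  · exact (mem_supported R _).2 (Set.subset_iUnion (fun n => (A n : Set M)) 0)

end StableSet

/-- Every projective module is a `κ`-directed union of direct summands of free modules of rank
`< κ`. -/
theorem isCardinalFilteredGenerator_smallFree [Fact κ.IsRegular] (hκ : IsStronglyCompact κ)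
    (hR : #R < κ) : (smallFree κ R).retractClosure.IsCardinalFilteredGenerator κ where
  le_isCardinalPresentable := by
    rw [ObjectProperty.retractClosure_le_iff]
    rintro _ ⟨X⟩
    exact isCardinalPresentable_freeObj hκ hR X.2
  exists_colimitsOfShape P := by
    obtain ⟨s, hs⟩ := Module.projective_def'.1 P.property
    have hJ : IsCardinalFiltered (StableSet κ s) κ := StableSet.isCardinalFiltered
    have := isFiltered_of_isCardinalFiltered (StableSet κ s) κ
    have hproj (Y : StableSet κ s) : Module.Projective R Y.submodule := by
      obtain ⟨i, r, h⟩ := Y.exists_retract hs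
      exact Module.Projective.of_split i r h
    let D : StableSet κ s ⥤ ProjectiveModuleCat R :=
      { obj Y := ⟨ModuleCat.of R Y.submodule, hproj Y⟩
        map f := ObjectProperty.homMk
          (ModuleCat.ofHom (Submodule.inclusion (StableSet.submodule_mono (leOfHom f)))) }
    let t : D ⟶ (Functor.const (StableSet κ s)).obj P :=
      { app Y := ObjectProperty.homMk (ModuleCat.ofHom Y.submodule.subtype) }
    refine ⟨StableSet κ s, inferInstance, hJ, ⟨⟨⟨D, t, ?_⟩, fun Y => ?_⟩⟩⟩
    · refine isColimitOfReflects (ObjectProperty.ι _ ⋙ forget (ModuleCat.{u} R)) ?_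
      refine Types.FilteredColimit.isColimitOf' _ _ (fun m => ?_) (fun Y m m' h => ?_)
      · obtain ⟨Y, hY⟩ := StableSet.exists_mem_submodule (s := s) hκ.aleph0_lt m
        exact ⟨Y, ⟨m, hY⟩, rfl⟩
      · exact ⟨Y, 𝟙 Y, congrArg _ (Subtype.ext h)⟩
    · obtain ⟨i, r, h⟩ := Y.exists_retract hs
      have hret : Retract (D.obj Y) (freeObj R Y.1) :=
        { i := ObjectProperty.homMk (ModuleCat.ofHom i)
          r := ObjectProperty.homMk (ModuleCat.ofHom r)
          retract := ObjectProperty.hom_ext _ (ModuleCat.hom_ext h) }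
      exact ObjectProperty.prop_of_retract _ hret (retractClosure_smallFree_freeObj Y.2.1)

end Category

theorem theorem3p3 (κ : Cardinal.{u}) (hκ : IsStronglyCompact κ) (R : Type u) [Ring R]
    (hR : Cardinal.mk R < κ) :
    (∀ (B C : Type u) [AddCommGroup B] [Module R B] [AddCommGroup C] [Module R C]
        (g : B →ₗ[R] C), Module.Projective R B → IsPureEpi κ g →
        ∃ s : C →ₗ[R] B, g ∘ₗ s = LinearMap.id) ∧
      ∃ _ : Fact κ.IsRegular, IsCardinalAccessibleCategory (ProjectiveModuleCat R) κ := by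
  refine ⟨fun B C _ _ _ _ g hB hg => ?_, ⟨hκ.isRegular⟩, ?_⟩
  · have := hg.projective hκ hR
    exact Module.projective_lifting_property g LinearMap.id hg.surjective
  · have : Fact κ.IsRegular := ⟨hκ.isRegular⟩
    have : HasCardinalFilteredGenerator (ProjectiveModuleCat R) κ :=
      { exists_generator := ⟨(smallFree κ R).retractClosure, by unfold smallFree; infer_instance,
          isCardinalFilteredGenerator_smallFree hκ hR⟩ }
    have : HasCardinalFilteredColimits (ProjectiveModuleCat R) κ := ⟨fun J _ _ => by
      have := isClosedUnderColimitsOfShape_projective hκ hR J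
      infer_instance⟩
    exact {}
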